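/- **Setting.** A clause is a finite set of literals, $\bot$ is the empty clause, a CNF is a finite multiset of clauses. A MaxSAT instance consists of a CNF $H_0$ of hard clauses and a finite set $B=\{b_1,\dots,b_m\}$ of (distinct) blocking variables, which give the soft clauses $S_0=\{\lnot b_1,\dots,\lnot b_m\}$; $X$ is the set of variables occurring in $H_0\cup S_0$. For a total assignment $\alpha$, $\mathrm{cost}(\alpha)=\sum_{i}\alpha(b_i)$, and for a satisfiable CNF $\Gamma$, $\mathrm{cost}(\Gamma)=\min\{\mathrm{cost}(\alpha):\alpha\models\Gamma\}$. A substitution $\sigma$ maps each variable of $X$ to $0$, $1$ or a literal over $X$; it is a partial assignment, with domain $\sigma^{-1}(\{0,1\})$, if $\sigma(x)\in\{0,1,x\}$ for all $x$. $\Gamma{\upharpoonright}_\sigma$ denotes restriction (clauses that become $1$ are removed, literals that become $0$ are deleted). For a non-tautological clause $C$, $\lnot C$ is the smallest partial assignment that falsifies $C$. $\Gamma\vdash_1 D$ means that unit propagation on $\Gamma{\upharpoonright}_{\lnot D}$ produces $\bot$ (or that $D$ is a tautology), and $\Gamma\vdash_1\Delta$ means $\Gamma\vdash_1 D$ for all $D\in\Delta$.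 *Redundancy rules.* A non-tautological clause $C$ is *cost-SR* w.r.t. $\Gamma$ if there is a substitution $\sigma$ with $\Gamma{\upharpoonright}_{\lnot C}\vdash_1(\Gamma\cup\{C\}){\upharpoonright}_\sigma$ and $\mathrm{cost}(\tau\circ\sigma)\le\mathrm{cost}(\tau)$ for all total assignments $\tau\supseteq\lnot C$. It is *cost-PR* if moreover $\sigma$ can be chosen to be a partial assignment; *cost-SPR* if $\sigma$ can be chosen to be a partial assignment with the same domain as $\lnot C$; *cost-LPR* if in addition $\sigma$ differs from $\lnot C$ on exactly one variable. A clause $C\lor\ell$ is *cost-BC* w.r.t. $\Gamma$ if $C\lor D$ is a tautology for every $D\lor\lnot\ell\in\Gamma$, and $\ell$ is not a blocking variable with positive polarity. *The system.* Let $P$ be one of these five rules. A derivation in MaxSAT resolution $+$ $P$ is a finite sequence of pairs of multisets of clauses over $X$ that starts with $(H_0,S_0)$, in which each pair arises from the previous pair $(H,S)$ in one of the following ways: (a) add to $H$ a clause obtained from clauses of $H$ by one application of weakening ($A\Rightarrow A'$ for $A\subseteq A'$) or of resolution ($A\lor x,\ A'\lor\lnot x\Rightarrow A\lor A'$); (a')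 add to $H$ a clause that is redundant w.r.t. $H$ by the rule $P$; (b) add to $S$ a clause of $H$; (c) replace one occurrence of a clause $C$ in $S$ by the two clauses $C\lor x$, $C\lor\lnot x$; (d) replace one occurrence of each of $C\lor x$, $C\lor\lnot x$ in $S$ by one occurrence of $C$. The system proves that the instance has cost at least $k$ if some derivation reaches a pair $(H,S)$ such that $S$ contains $k$ copies of $\bot$. **Theorem (completeness of MaxSAT resolution $+$ $P$).** Let $P$ be any of cost-SR, cost-PR, cost-SPR, cost-LPR, cost-BC. The system MaxSAT resolution $+$ $P$ is complete: for every MaxSAT instance with satisfiable hard clauses $H_0$ and soft clauses $S_0=\{\lnot b_1,\dots,\lnot b_m\}$, if $\mathrm{cost}(H_0)=k$, then there is a derivation in MaxSAT resolution $+$ $P$ from $(H_0,S_0)$ that reaches soft clauses containing $k$ copies of $\bot$. -/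

import Mathlib

namespace MaxSATRes

variable {V : Type*} [DecidableEq V]

/-- A literal over the variables `V`: `(x, true)` is `x` and `(x, false)` is `¬ x`. -/
abbrev Lit (V : Type*) := V × Bool

/-- The complementary literal. -/
def Lit.neg (l : Lit V) : Lit V := (l.1, !l.2)

/-- A clause is a finite disjunction of literals; `∅` is the empty clause `⊥`. -/
abbrev Clause (V : Type*) := Finset (Lit V)

/-- A CNF is the multiset of its clauses. -/
abbrev CNF (V : Type*) := Multiset (Clause V)

/-- The set of variables of a clause. -/
def Clause.vars (C : Clause V) : Finset V := C.image Prod.fst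

/-- The set of variables of a CNF. -/
def CNF.vars (G : CNF V) : Finset V := G.toFinset.biUnion Clause.vars

/-- A clause is a tautology when it contains two complementary literals. -/
def Clause.Taut (C : Clause V) : Prop := ∃ l ∈ C, Lit.neg l ∈ C

/-! ### Total assignments and cost -/

/-- The value of a literal under a total assignment. -/
def evalLit (a : V → Bool) (l : Lit V) : Bool := if l.2 then a l.1 else !(a l.1)

/-- A total assignment satisfies every clause of a CNF. -/
def Satisfies (a : V → Bool) (G : CNF V) : Prop :=
  ∀ C ∈ G, ∃ l ∈ C, evalLit a l = true

/-- The cost of a total assignment: the number of blocking variables set to true. -/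
def assignCost (B : Finset V) (a : V → Bool) : ℕ := ∑ b ∈ B, (if a b then 1 else 0)

/-- The cost of an instance with hard clauses `G` and blocking variables `B`: the least cost of
a total assignment satisfying `G` (meaningful when `G` is satisfiable). -/
noncomputable def cost (B : Finset V) (G : CNF V) : ℕ :=
  sInf {k | ∃ a : V → Bool, Satisfies a G ∧ assignCost B a = k}

/-! ### Substitutions and restrictions -/

/-- A substitution sends a variable to a constant (`Sum.inl`) or to a literal (`Sum.inr`). -/
abbrev Subst (V : Type*) := V → Bool ⊕ Lit V

/-- The extension of a substitution to literals. -/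
def Subst.onLit (s : Subst V) (l : Lit V) : Bool ⊕ Lit V :=
  match s l.1, l.2 with
  | Sum.inl c, true => Sum.inl c
  | Sum.inl c, false => Sum.inl (!c)
  | Sum.inr k, true => Sum.inr k
  | Sum.inr k, false => Sum.inr (Lit.neg k)

/-- `s` is a substitution for the variables in `X`; outside of `X` it is the identity. -/
def Subst.IsOn (s : Subst V) (X : Finset V) : Prop :=
  (∀ x ∈ X, ∀ l, s x = Sum.inr l → l.1 ∈ X) ∧ ∀ x, x ∉ X → s x = Sum.inr (x, true)

/-- A (partial) assignment: each variable goes to a constant or to itself. -/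
def Subst.IsAssignment (s : Subst V) : Prop :=
  ∀ x, (∃ c, s x = Sum.inl c) ∨ s x = Sum.inr (x, true)

/-- The variables that are sent to constants. -/
def Subst.dom (s : Subst V) : Set V := {x | ∃ c, s x = Sum.inl c}

/-- The composition `τ ∘ s` of a total assignment with a substitution. -/
def Subst.thenAssign (s : Subst V) (τ : V → Bool) : V → Bool := fun x =>
  match s x with
  | Sum.inl c => c
  | Sum.inr l => evalLit τ l

/-- The assignment that makes the literal `l` true and leaves all other variables alone. -/
def litSubst (l : Lit V) : Subst V := fun x => if x = l.1 then Sum.inl l.2 else Sum.inr (x, true)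

/-- The assignment `¬ C` that makes all literals of the (non-tautological) clause `C` false. -/
def negSubst (C : Clause V) : Subst V := fun x =>
  if (x, true) ∈ C then Sum.inl false
  else if (x, false) ∈ C then Sum.inl true
  else Sum.inr (x, true)

/-- The total assignment `τ` extends the assignment `s`. -/
def Extends (τ : V → Bool) (s : Subst V) : Prop := ∀ x c, s x = Sum.inl c → τ x = c

/-- The clause `C` restricted by `s`, when this is not the constant `1`:
the literals of `C` that become `0` vanish, the others are replaced by their images. -/
def Clause.restrict (s : Subst V) (C : Clause V) : Clause V :=
  C.biUnion fun l =>
    match s.onLit l with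
    | Sum.inl _ => ∅
    | Sum.inr k => {k}

/-- The restriction of a CNF: clauses that become `1` are removed, the others are restricted. -/
def CNF.restrict (s : Subst V) (G : CNF V) : CNF V :=
  (G.filter fun C => ¬ ∃ l ∈ C, s.onLit l = Sum.inl true).map (Clause.restrict s)

/-! ### Unit propagation -/

/-- One step of unit propagation: pick a unit clause `l`, remove all clauses that contain `l`, and
remove the complement of `l` from all other clauses. -/
inductive UnitStep : CNF V → CNF V → Prop
  | unit (G : CNF V) (l : Lit V) (h : {l} ∈ G) : UnitStep G (CNF.restrict (litSubst l) G)

/-- Unit propagation on `G` produces the empty clause. -/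
def UnitRefutes (G : CNF V) : Prop := ∃ G', Relation.ReflTransGen UnitStep G G' ∧ ∅ ∈ G'

/-- `G ⊢₁ D`. For a tautological clause the units `¬ l`, `l ∈ D`, clash at once. -/
def UnitImplies (G : CNF V) (D : Clause V) : Prop :=
  D.Taut ∨ UnitRefutes (CNF.restrict (negSubst D) G)

/-- `G ⊢₁ D` for every clause `D` of a CNF. -/
def UnitImpliesCNF (G D : CNF V) : Prop := ∀ C ∈ D, UnitImplies G C

/-! ### Redundancy rules

`B` is the set of blocking variables, `X` the set of variables of the instance. -/

/-- `C` is cost substitution redundant with respect to `G`, with witness `s`. -/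
def IsCostSRWith (B X : Finset V) (G : CNF V) (C : Clause V) (s : Subst V) : Prop :=
  ¬ C.Taut ∧ s.IsOn X ∧
  UnitImpliesCNF (CNF.restrict (negSubst C) G) (CNF.restrict s (C ::ₘ G)) ∧
  ∀ τ : V → Bool, Extends τ (negSubst C) → assignCost B (s.thenAssign τ) ≤ assignCost B τ

def IsCostSR (B X : Finset V) (G : CNF V) (C : Clause V) : Prop :=
  ∃ s, IsCostSRWith B X G C s

def IsCostPR (B X : Finset V) (G : CNF V) (C : Clause V) : Prop :=
  ∃ s, IsCostSRWith B X G C s ∧ s.IsAssignment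

def IsCostSPR (B X : Finset V) (G : CNF V) (C : Clause V) : Prop :=
  ∃ s, IsCostSRWith B X G C s ∧ s.IsAssignment ∧ s.dom = (negSubst C).dom

def IsCostLPR (B X : Finset V) (G : CNF V) (C : Clause V) : Prop :=
  ∃ s, IsCostSRWith B X G C s ∧ s.IsAssignment ∧ s.dom = (negSubst C).dom ∧
    ∃! x, s x ≠ negSubst C x

/-- The clause `E = C ∨ l` is cost blocked with respect to `G` on some literal `l` that is not a
positive blocking literal. -/
def IsCostBC (B : Finset V) (G : CNF V) (E : Clause V) : Prop :=
  ∃ (C : Clause V) (l : Lit V), l ∉ C ∧ E = insert l C ∧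
    (∀ D : Clause V, insert (Lit.neg l) D ∈ G → Clause.Taut (C ∪ D)) ∧
    ¬ (l.1 ∈ B ∧ l.2 = true)

/-- The five redundancy rules. -/
inductive Rule
  | costSR
  | costPR
  | costSPR
  | costLPR
  | costBC

/-- `C` is redundant with respect to `G` by the rule `P`. -/
def Rule.Redundant (P : Rule) (B X : Finset V) (G : CNF V) (C : Clause V) : Prop :=
  match P with
  | Rule.costSR => IsCostSR B X G C
  | Rule.costPR => IsCostPR B X G C
  | Rule.costSPR => IsCostSPR B X G C
  | Rule.costLPR => IsCostLPR B X G C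
  | Rule.costBC => IsCostBC B G C

/-! ### MaxSAT resolution + P -/

/-- One application of a resolution rule (weakening, resolution) to clauses of `H`. -/
inductive ResolutionStep (H : CNF V) : Clause V → Prop
  | weaken (A C : Clause V) (hA : A ∈ H) (hAC : A ⊆ C) : ResolutionStep H C
  | resolve (A C : Clause V) (x : V) (hA : insert (x, true) A ∈ H)
      (hC : insert (x, false) C ∈ H) : ResolutionStep H (A ∪ C)

/-- One step of MaxSAT resolution + `P` on pairs (hard clauses, soft clauses). No variable
outside of `X` may be introduced. -/
inductive Step (P : Rule) (B X : Finset V) : CNF V × CNF V → CNF V × CNF V → Prop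
  | hardResolution (H S : CNF V) (C : Clause V) (h : ResolutionStep H C) (hX : C.vars ⊆ X) :
      Step P B X (H, S) (C ::ₘ H, S)
  | hardRedundancy (H S : CNF V) (C : Clause V) (h : P.Redundant B X H C) (hX : C.vars ⊆ X) :
      Step P B X (H, S) (C ::ₘ H, S)
  | copy (H S : CNF V) (C : Clause V) (h : C ∈ H) :
      Step P B X (H, S) (H, C ::ₘ S)
  | split (H S : CNF V) (C : Clause V) (x : V) (hx : x ∈ X) :
      Step P B X (H, C ::ₘ S) (H, insert (x, true) C ::ₘ insert (x, false) C ::ₘ S)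
  | merge (H S : CNF V) (C : Clause V) (x : V) (hx : x ∈ X) :
      Step P B X (H, insert (x, true) C ::ₘ insert (x, false) C ::ₘ S) (H, C ::ₘ S)

/-- The soft clauses `¬ b`, one for every blocking variable `b`. -/
def softUnits (B : Finset V) : CNF V := B.val.map fun b => {(b, false)}

/-- MaxSAT resolution + `P` proves that the instance with hard clauses `H₀` and soft clauses
`¬ b`, `b ∈ B`, has cost at least `k`: a derivation that uses only the variables of the instance
reaches soft clauses among which there are `k` copies of the empty clause. -/
def ProvesCostAtLeast (P : Rule) (B : Finset V) (H₀ : CNF V) (k : ℕ) : Prop :=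
  ∃ H S : CNF V,
    Relation.ReflTransGen (Step P B (CNF.vars (H₀ + softUnits B))) (H₀, softUnits B) (H, S) ∧
    k ≤ S.count ∅

end MaxSATRes

namespace MaxSATRes

section Completeness

variable {V : Type*} [DecidableEq V]

/-! Splitting ⊥ on every variable of X yields the full clauses over X, one for each assignment a to
X, namely the clause that a falsifies. Merging reverses this, so it suffices to have k = cost(H₀)
soft copies of each full clause D. If D contains a hard clause, D is a weakening of it and can be
copied into the soft clauses k times. Otherwise a satisfies H₀, so a sets at least k blocking
variables to 1; splitting each corresponding ¬b on the other variables produces D, which gives k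
copies at no charge. The count is `cost_nsmul_expand_le`. Weakening, copying, splitting and merging
suffice, so the argument is uniform in `P`. -/

/-- All clauses that extend `C` by one literal for every variable of the list. -/
def expand : List V → Clause V → CNF V
  | [], C => {C}
  | x :: L, C => expand L (insert (x, true) C) + expand L (insert (x, false) C)

/-- The clause over the variables of `L` that `a` falsifies. -/
def falsified (a : V → Bool) (L : List V) : Clause V := L.toFinset.image fun x => (x, !(a x))

/-! ### Full clauses and assignments -/

theorem mem_falsified {a : V → Bool} {L : List V} {y : V} {s : Bool} :
    (y, s) ∈ falsified a L ↔ y ∈ L ∧ s = !(a y) := by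
  simp only [falsified, Finset.mem_image, List.mem_toFinset, Prod.mk.injEq]
  constructor
  · rintro ⟨x, hx, rfl, rfl⟩
    exact ⟨hx, rfl⟩
  · rintro ⟨hy, rfl⟩
    exact ⟨y, hy, rfl, rfl⟩

theorem union_falsified_mem_expand (a : V → Bool) (L : List V) (C : Clause V) :
    C ∪ falsified a L ∈ expand L C := by
  induction L generalizing C with
  | nil => simp [expand, falsified]
  | cons x L ih =>
    have key : C ∪ falsified a (x :: L) = insert (x, !(a x)) C ∪ falsified a L := by
      simp [falsified, Finset.image_insert, Finset.insert_union, Finset.union_insert]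
    rw [key, expand, Multiset.mem_add]
    cases h : a x
    · exact Or.inl (ih _)
    · exact Or.inr (ih _)

theorem mem_of_mem_expand {L : List V} {C D : Clause V} (hD : D ∈ expand L C) {x : V}
    (hx : x ∉ L) (s : Bool) : (x, s) ∈ D ↔ (x, s) ∈ C := by
  induction L generalizing C with
  | nil => rw [Multiset.mem_singleton.1 hD]
  | cons y L ih =>
    simp only [List.mem_cons, not_or] at hx
    rw [expand, Multiset.mem_add] at hD
    rcases hD with hD | hD <;> rw [ih hD hx.2] <;> simp [hx.1]

theorem mem_expand_iff_not {L : List V} {C D : Clause V} (hL : L.Nodup)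
    (hC : ∀ x ∈ L, ∀ s, (x, s) ∉ C) (hD : D ∈ expand L C) {x : V} (hx : x ∈ L) :
    (x, true) ∈ D ↔ (x, false) ∉ D := by
  induction L generalizing C with
  | nil => simp at hx
  | cons y L ih =>
    rw [List.nodup_cons] at hL
    have hCy := hC y List.mem_cons_self
    have hCL : ∀ c, ∀ z ∈ L, ∀ s, (z, s) ∉ insert (y, c) C := by
      intro c z hz s hmem
      rcases Finset.mem_insert.1 hmem with h | h
      · exact hL.1 ((Prod.mk.inj h).1 ▸ hz)
      · exact hC z (List.mem_cons_of_mem _ hz) s h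
    rw [expand, Multiset.mem_add] at hD
    rcases List.mem_cons.1 hx with rfl | hx
    · rcases hD with hD | hD <;>
        rw [mem_of_mem_expand hD hL.1, mem_of_mem_expand hD hL.1] <;> simp [hCy]
    · rcases hD with hD | hD
      · exact ih hL.2 (hCL _) hD hx
      · exact ih hL.2 (hCL _) hD hx

/-- The two halves of a split differ in the sign of the split variable, and later splits leave that
variable alone. -/
theorem nodup_expand {L : List V} {C : Clause V} (hL : L.Nodup)
    (hC : ∀ x ∈ L, ∀ s, (x, s) ∉ C) : (expand L C).Nodup := by
  induction L generalizing C with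
  | nil => exact Multiset.nodup_singleton _
  | cons y L ih =>
    rw [List.nodup_cons] at hL
    have hCy := hC y List.mem_cons_self
    have hCL : ∀ c, ∀ z ∈ L, ∀ s, (z, s) ∉ insert (y, c) C := by
      intro c z hz s hmem
      rcases Finset.mem_insert.1 hmem with h | h
      · exact hL.1 ((Prod.mk.inj h).1 ▸ hz)
      · exact hC z (List.mem_cons_of_mem _ hz) s h
    rw [expand, Multiset.nodup_add]
    refine ⟨ih hL.2 (hCL _), ih hL.2 (hCL _), Multiset.disjoint_left.2 fun {D} h₁ h₂ => ?_⟩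
    have h := (mem_of_mem_expand h₁ hL.1 true).2 (Finset.mem_insert_self _ _)
    have h' := (mem_of_mem_expand h₂ hL.1 true).1 h
    simp [hCy] at h'

theorem exists_eq_falsified_of_mem_expand {L : List V} {D : Clause V} (hL : L.Nodup)
    (hD : D ∈ expand L ∅) : ∃ a : V → Bool, D = falsified a L := by
  -- The sign of `x` in `D` dictates the value: `D` is falsified when `x` is true exactly if ¬x
  -- occurs in it.
  refine ⟨fun x => decide ((x, false) ∈ D), ?_⟩
  ext ⟨x, s⟩
  rw [mem_falsified]
  by_cases hx : x ∈ L
  · have h := mem_expand_iff_not hL (by simp) hD hx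
    cases s <;> simp [hx, h]
  · simp [hx, mem_of_mem_expand hD hx]

/-! ### Derivations by splitting, merging, weakening and copying -/

section Derivations

variable {P : Rule} {B X : Finset V}

theorem derives_expand (H : CNF V) {L : List V} (hL : ∀ x ∈ L, x ∈ X) (C : Clause V)
    (S : CNF V) : Relation.ReflTransGen (Step P B X) (H, C ::ₘ S) (H, expand L C + S) := by
  induction L generalizing C S with
  | nil => exact Relation.ReflTransGen.refl
  | cons x L ih =>
    have ih := fun C S => ih (fun y hy => hL y (List.mem_cons_of_mem _ hy)) C S
    refine .head (Step.split H S C x (hL x List.mem_cons_self)) ((ih _ _).trans ?_)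
    rw [Multiset.add_cons]
    refine (ih _ _).trans ?_
    rw [expand, ← add_assoc, add_comm (expand L (insert (x, false) C))]

theorem derives_of_expand (H : CNF V) {L : List V} (hL : ∀ x ∈ L, x ∈ X) (C : Clause V)
    (S : CNF V) : Relation.ReflTransGen (Step P B X) (H, expand L C + S) (H, C ::ₘ S) := by
  induction L generalizing C S with
  | nil => exact Relation.ReflTransGen.refl
  | cons x L ih =>
    have ih := fun C S => ih (fun y hy => hL y (List.mem_cons_of_mem _ hy)) C S
    refine .tail ?_ (Step.merge H S C x (hL x List.mem_cons_self))
    rw [expand, add_assoc]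
    refine (ih _ _).trans ?_
    rw [← Multiset.add_cons]
    refine (ih _ _).trans ?_
    rw [Multiset.cons_swap]

theorem derives_replicate (H : CNF V) {L : List V} (hL : ∀ x ∈ L, x ∈ X) (C : Clause V)
    (k : ℕ) (S : CNF V) : Relation.ReflTransGen (Step P B X) (H, k • expand L C + S)
      (H, Multiset.replicate k C + S) := by
  induction k generalizing S with
  | zero => simpa using Relation.ReflTransGen.refl
  | succ k ih =>
    rw [succ_nsmul, add_assoc]
    refine (ih _).trans ?_
    rw [add_left_comm, Multiset.replicate_succ, Multiset.cons_add]
    exact derives_of_expand H hL C _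

/-- Omitting `b` from the split variables makes the results full clauses over `L` (when `b` occurs
there once), all containing ¬b. -/
theorem derives_softExpansion (H : CNF V) {L : List V} (hL : ∀ x ∈ L, x ∈ X) (T : Multiset V)
    (S : CNF V) : Relation.ReflTransGen (Step P B X) (H, T.map (fun b => {(b, false)}) + S)
      (H, (T.map fun b => expand (L.erase b) {(b, false)}).sum + S) := by
  induction T using Multiset.induction_on generalizing S with
  | empty => simpa using Relation.ReflTransGen.refl
  | cons b T ih =>
    rw [Multiset.map_cons, Multiset.cons_add, Multiset.map_cons, Multiset.sum_cons]
    refine (derives_expand H (L := L.erase b) (fun x hx => hL x (List.mem_of_mem_erase hx)) _ _).trans ?_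
    rw [add_left_comm, add_assoc, add_left_comm _ (Multiset.sum _)]
    exact ih _

theorem derives_copies {H : CNF V} {C : Clause V} (hC : C ∈ H) (k : ℕ) (S : CNF V) :
    Relation.ReflTransGen (Step P B X) (H, S) (H, Multiset.replicate k C + S) := by
  induction k with
  | zero => simpa using Relation.ReflTransGen.refl
  | succ k ih =>
    rw [Multiset.replicate_succ, Multiset.cons_add]
    exact ih.tail (Step.copy _ _ _ hC)

/-- One weakening per clause suffices, since a hard clause may be copied repeatedly. The induction
varies `H` because hard clauses only accumulate, so earlier subsuming clauses remain available. -/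
theorem derives_weakenings (k : ℕ) (T : CNF V) (H S : CNF V)
    (hT : ∀ D ∈ T, D.vars ⊆ X ∧ ∃ A ∈ H, A ⊆ D) :
    ∃ H', Relation.ReflTransGen (Step P B X) (H, S) (H', k • T + S) := by
  induction T using Multiset.induction_on generalizing H S with
  | empty => exact ⟨H, by simpa using Relation.ReflTransGen.refl⟩
  | cons D T ih =>
    obtain ⟨hX, A, hA, hAD⟩ := hT D (Multiset.mem_cons_self _ _)
    obtain ⟨H', h⟩ := ih (D ::ₘ H) (Multiset.replicate k D + S) fun E hE => by
      obtain ⟨hE, A, hA, hAE⟩ := hT E (Multiset.mem_cons_of_mem hE)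
      exact ⟨hE, A, Multiset.mem_cons_of_mem hA, hAE⟩
    refine ⟨H', .head (Step.hardResolution H S D (.weaken A D hA hAD) hX)
      ((derives_copies (Multiset.mem_cons_self _ _) k S).trans ?_)⟩
    rwa [← Multiset.singleton_add D T, nsmul_add, Multiset.nsmul_singleton,
      add_assoc, add_left_comm]

end Derivations

/-! ### Counting copies of full clauses -/

theorem satisfies_of_not_subset_falsified {a : V → Bool} {L : List V} {G : CNF V}
    (hG : ∀ x ∈ CNF.vars G, x ∈ L) (h : ∀ A ∈ G, ¬ A ⊆ falsified a L) : Satisfies a G := by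
  intro A hA
  obtain ⟨⟨x, s⟩, hl, hn⟩ := Finset.not_subset.1 (h A hA)
  refine ⟨(x, s), hl, ?_⟩
  have hx : x ∈ L := hG x <| Finset.mem_biUnion.2
    ⟨A, Multiset.mem_toFinset.2 hA, Finset.mem_image.2 ⟨_, hl, rfl⟩⟩
  rw [mem_falsified] at hn
  cases s <;> simpa [evalLit, hx] using hn

theorem falsified_mem_expand_erase {a : V → Bool} {L : List V} {b : V} (hL : L.Nodup)
    (hb : b ∈ L) (ha : a b = true) : falsified a L ∈ expand (L.erase b) {(b, false)} := by
  convert union_falsified_mem_expand a (L.erase b) {(b, false)} using 1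
  ext ⟨x, s⟩
  simp only [Finset.mem_union, Finset.mem_singleton, mem_falsified, hL.mem_erase_iff,
    Prod.mk.injEq]
  by_cases hx : x = b
  · subst hx
    simp [hb, ha]
  · simp [hx]

/-- Every blocking variable that `a` sets to true contributes at least one copy, from the expansion
of its own soft clause. -/
theorem assignCost_le_count {B : Finset V} {L : List V} (hL : L.Nodup) (hB : ∀ b ∈ B, b ∈ L)
    (a : V → Bool) : assignCost B a ≤
      (B.val.map fun b => expand (L.erase b) {(b, false)}).sum.count (falsified a L) := by
  change _ ≤ Multiset.count _ (∑ b ∈ B, expand (L.erase b) {(b, false)})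
  rw [Multiset.count_sum']
  refine Finset.sum_le_sum fun b hb => ?_
  split_ifs with h
  · exact Multiset.one_le_count_iff_mem.2 (falsified_mem_expand_erase hL (hB b hb) h)
  · exact Nat.zero_le _

open Classical in
theorem cost_nsmul_expand_le {B : Finset V} {H : CNF V} {L : List V} (hL : L.Nodup)
    (hB : ∀ b ∈ B, b ∈ L) (hH : ∀ x ∈ CNF.vars H, x ∈ L) :
    cost B H • expand L ∅ ≤ cost B H • (expand L ∅).filter (fun D => ∃ A ∈ H, A ⊆ D) +
      (B.val.map fun b => expand (L.erase b) {(b, false)}).sum := by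
  rw [Multiset.le_iff_count]
  intro D
  rw [Multiset.count_add, Multiset.count_nsmul, Multiset.count_nsmul, Multiset.count_filter]
  by_cases hD : D ∈ expand L ∅
  · split_ifs with h
    · exact Nat.le_add_right _ _
    · obtain ⟨a, rfl⟩ := exists_eq_falsified_of_mem_expand hL hD
      push Not at h
      rw [Multiset.count_eq_one_of_mem (nodup_expand hL (by simp)) hD, mul_one, mul_zero, zero_add]
      -- No hard clause lies inside the clause falsified by `a`, so `a` satisfies `H` and competes
      -- in the minimum defining the cost.
      exact le_trans (Nat.sInf_le ⟨a, satisfies_of_not_subset_falsified hH h, rfl⟩)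
        (assignCost_le_count hL hB a)
  · simp [Multiset.count_eq_zero_of_notMem hD]

end Completeness

end MaxSATRes

theorem mainTheorem10 {V : Type*} [DecidableEq V] (P : MaxSATRes.Rule)
    (H₀ : MaxSATRes.CNF V) (B : Finset V)
    (hsat : ∃ a : V → Bool, MaxSATRes.Satisfies a H₀) :
    MaxSATRes.ProvesCostAtLeast P B H₀ (MaxSATRes.cost B H₀) := by
  classical
  open MaxSATRes in
  set X := CNF.vars (H₀ + softUnits B) with hX
  have hXL : ∀ x ∈ X.toList, x ∈ X := fun x => Finset.mem_toList.1
  have hH : ∀ x ∈ CNF.vars H₀, x ∈ X.toList := by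
    intro x hx
    obtain ⟨A, hA, hxA⟩ := Finset.mem_biUnion.1 hx
    exact Finset.mem_toList.2 <| Finset.mem_biUnion.2
      ⟨A, Multiset.mem_toFinset.2 (Multiset.mem_add.2 (.inl (Multiset.mem_toFinset.1 hA))), hxA⟩
  have hB : ∀ b ∈ B, b ∈ X.toList := by
    intro b hb
    refine Finset.mem_toList.2 <| Finset.mem_biUnion.2 ⟨{(b, false)},
      Multiset.mem_toFinset.2 (Multiset.mem_add.2 (.inr (Multiset.mem_map.2 ⟨b, hb, rfl⟩))), ?_⟩
    simp [Clause.vars]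
  obtain ⟨H', hH'⟩ := derives_weakenings (P := P) (B := B) (X := X) (cost B H₀)
    ((expand X.toList ∅).filter fun D => ∃ A ∈ H₀, A ⊆ D) H₀
    (B.val.map fun b => expand (X.toList.erase b) {(b, false)}).sum (by
      intro D hD
      rw [Multiset.mem_filter] at hD
      refine ⟨fun x hx => ?_, hD.2⟩
      obtain ⟨⟨y, s⟩, hl, rfl⟩ := Finset.mem_image.1 hx
      -- A variable not split on could only come from the root clause, which is empty.
      by_contra hy
      simpa using (mem_of_mem_expand hD.1 (fun h => hy (hXL _ h)) s).1 hl)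
  -- `R` collects the surplus soft clauses, which stay untouched during the merging.
  obtain ⟨R, hR⟩ := Multiset.le_iff_exists_add.1
    (cost_nsmul_expand_le X.nodup_toList hB hH)
  have hS := derives_softExpansion (P := P) (B := B) H₀ hXL B.val 0
  rw [add_zero, add_zero] at hS
  rw [hR] at hH'
  refine ⟨H', _, (hS.trans hH').trans (derives_replicate H' hXL ∅ (cost B H₀) R), ?_⟩
  rw [Multiset.count_add, Multiset.count_replicate_self]
  exact Nat.le_add_right _ _
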